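/- Let $p,q,c\in\mathbb{C}$ with $0<|p|<1$, $q\neq 0$, $c\neq 0$, and let $0\le m\le N$ be integers. Put $(x;p)_\infty=\prod_{n\ge 0}(1-xp^n)$, $\theta(x;p)=(x;p)_\infty(p/x;p)_\infty$ for $x\ne0$, $(x;q,p)_n=\prod_{k=0}^{n-1}\theta(xq^k;p)$, $(x,y;q,p)_n=(x;q,p)_n(y;q,p)_n$, and $$P(x)=\theta(-x^2;p^2)\,(-p;p)_\infty,\qquad Q(x)=x\,\theta(-px^2;p^2)\,(-p;p)_\infty .$$ Let $W_c^N$ be the complex linear span of all functions $h_k(x)/(cx,c/x;q,p)_k$, where $0\le k\le N$ and $h_k$ runs over all functions holomorphic on $\mathbb{C}\setminus\{0\}$ with $$h_k(x)=h_k(1/x),\qquad h_k(px)=\frac{1}{p^kx^{2k}}\,h_k(x)\qquad(x\ne0);$$ these are functions on the set $U=\{x\in\mathbb{C}\setminus\{0\}:(cx,c/x;q,p)_N\neq0\}$. Let $g_m$ be a complex-valued function such that $g_m(x)/(cx,c/x;q,p)_m$, as a function on $U$, belongs to $W_c^N$. Then there are complex numbers $\lambda_0,\dots,\lambda_N$,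 independent of $x$, such that $$g_m(x)=\frac{1}{x^m}\Big(\sum_{k=0}^N\lambda_kP(x)^kQ(x)^{N-k}\Big)\prod_{k=0}^{N-m-1}\frac{1}{P(cq^{m+k})Q(x)-Q(cq^{m+k})P(x)}$$ for all $x\in U$, where the denominators do not vanish on $U$; the same identity (with the same $\lambda_k$) holds at every $x\ne 0$ at which $g_m$ is defined in a neighbourhood and continuous and the denominators do not vanish. In particular, for $m=N$, $$g_N(x)=\frac{1}{x^N}\sum_{k=0}^N\lambda_kP(x)^kQ(x)^{N-k}$$ for all $x\in U$ and at every $x\ne0$ at which $g_N$ is continuous; that is, $x^Ng_N(x)$ is an elliptic Askey–Wilson polynomial of degree $N$ (a homogeneous polynomial of degree $N$ in $P(x)$ and $Q(x)$). -/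

import Mathlib

namespace EllipticAW

noncomputable section

/-- The infinite `p`-shifted factorial `(x; p)_∞ = ∏_{n ≥ 0} (1 - x p ^ n)`, for `|p| < 1`. -/
def pochInf (x p : ℂ) : ℂ := ∏' n : ℕ, (1 - x * p ^ n)

/-- The modified Jacobi theta function `θ(x; p) = (x; p)_∞ (p / x; p)_∞`, for `x ≠ 0`. -/
def theta (x p : ℂ) : ℂ := pochInf x p * pochInf (p / x) p

/-- The theta shifted factorial `(x; q, p)_n = ∏_{k < n} θ(x q ^ k; p)`. -/
def thetaPoch (x q p : ℂ) (n : ℕ) : ℂ := ∏ k ∈ Finset.range n, theta (x * q ^ k) p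

/-- `(c x, c / x; q, p)_n = (c x; q, p)_n (c / x; q, p)_n`. -/
def thetaPoch₂ (c q p : ℂ) (n : ℕ) (x : ℂ) : ℂ :=
  thetaPoch (c * x) q p n * thetaPoch (c / x) q p n

/-- `P(x) = θ(-x²; p²) (-p; p)_∞`. -/
def P (p x : ℂ) : ℂ := theta (-x ^ 2) (p ^ 2) * pochInf (-p) p

/-- `Q(x) = x θ(-p x²; p²) (-p; p)_∞`. -/
def Q (p x : ℂ) : ℂ := x * theta (-(p * x ^ 2)) (p ^ 2) * pochInf (-p) p

/-- The elliptic Askey–Wilson polynomial of degree `N` with coefficients `lam 0, …, lam N`: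
`∑_{k = 0}^{N} lam k * P(x) ^ k * Q(x) ^ (N - k)`. -/
def askeyWilson (p : ℂ) (N : ℕ) (lam : Fin (N + 1) → ℂ) (x : ℂ) : ℂ :=
  ∑ k : Fin (N + 1), lam k * P p x ^ (k : ℕ) * Q p x ^ (N - (k : ℕ))

/-- The functions `g` that are holomorphic on `ℂ \ {0}` and satisfy there
`g(x) = g(1 / x)` and `g(p x) = g(x) / (p ^ k x ^ (2 k))`. -/
structure IsSymmTheta (p : ℂ) (k : ℕ) (g : ℂ → ℂ) : Prop where
  holo : DifferentiableOn ℂ g {0}ᶜ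
  symm : ∀ x : ℂ, x ≠ 0 → g x = g (1 / x)
  quasi : ∀ x : ℂ, x ≠ 0 → g (p * x) = 1 / (p ^ k * x ^ (2 * k)) * g x

/-- The points `x ≠ 0` at which `(c x, c / x; q, p)_N` does not vanish, that is, the common domain
of the functions that span the interpolation space. -/
def regularSet (p q c : ℂ) (N : ℕ) : Set ℂ := {x | x ≠ 0 ∧ thetaPoch₂ c q p N x ≠ 0}

/-- Schlosser's elliptic interpolation space `W_c^N`, as a space of functions on `regularSet`:
the span of all `g_k(x) / (c x, c / x; q, p)_k`, where `0 ≤ k ≤ N` and `g_k` runs over all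
functions with `IsSymmTheta p k g_k`. -/
def W (p q c : ℂ) (N : ℕ) : Submodule ℂ (regularSet p q c N → ℂ) :=
  Submodule.span ℂ {f | ∃ k ≤ N, ∃ g : ℂ → ℂ, IsSymmTheta p k g ∧
    f = fun x : regularSet p q c N => g x / thetaPoch₂ c q p k x}

/-- `∏_{k = 0}^{N - m - 1} (P(c q ^ (m + k)) Q(x) - Q(c q ^ (m + k)) P(x))`, for `m ≤ N`. -/
def denom (p q c : ℂ) (N m : ℕ) (x : ℂ) : ℂ :=
  ∏ k ∈ Finset.range (N - m),
    (P p (c * q ^ (m + k)) * Q p x - Q p (c * q ^ (m + k)) * P p x)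

end

end EllipticAW

/-! Over the common denominator `(c x, c / x; q, p)_N`, each missing factor `θ(c q^j x) θ(c q^j /
x)` is a symmetric theta function of degree 1, so every element of `W` has a numerator of degree `N`
(`exists_isSymmTheta_of_mem_W`).

Such numerators are the homogeneous polynomials of degree `N` in `P` and `Q`, divided by `x ^ N`
(`IsSymmTheta.exists_eq_askeyWilson`). Induct on the degree: subtract a multiple of `(Q / x) ^ N` so
that the function vanishes at `I`. By symmetry and quasi-periodicity it then vanishes at all zeros
of `P`, which are simple, so `P / x` divides it. In degree 0, Liouville's theorem gives a constant.

Degree 1 also yields `θ(y x) θ(y / x) = C (P(y) Q(x) - Q(y) P(x)) / x`, which turns the factors left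
after cancelling `(c x, c / x; q, p)_m` into `denom`. The constants `C` need not be known: they are
absorbed into the coefficients. Density of `regularSet` extends the identity to points of
continuity. -/

namespace EllipticAW

open Filter Topology

/-! ### Theta functions: functional equations, zeros and their simplicity -/

section Theta

variable {p : ℂ}

lemma summable_norm_neg_mul_pow (hp : ‖p‖ < 1) (x : ℂ) :
    Summable fun n : ℕ => ‖-(x * p ^ n)‖ := by
  simpa [norm_mul, norm_pow] using
    (summable_geometric_of_lt_one (norm_nonneg p) hp).mul_left ‖x‖

lemma multipliable_pochInf (hp : ‖p‖ < 1) (x : ℂ) :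
    Multipliable fun n : ℕ => 1 - x * p ^ n := by
  simpa [sub_eq_add_neg] using
    multipliable_one_add_of_summable (summable_norm_neg_mul_pow hp x)

lemma pochInf_eq_mul (hp : ‖p‖ < 1) (x : ℂ) :
    pochInf x p = (1 - x) * pochInf (x * p) p := by
  have h : (fun n : ℕ => 1 - x * p ^ (n + 1)) = fun n : ℕ => 1 - x * p * p ^ n := by
    ext n; ring
  have := tprod_eq_zero_mul' (f := fun n : ℕ => 1 - x * p ^ n)
    (by rw [h]; exact multipliable_pochInf hp (x * p))
  rw [h] at this
  simpa [pochInf] using this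

lemma exists_mul_pow_eq_one_of_pochInf_eq_zero (hp : ‖p‖ < 1) {x : ℂ} (hx : pochInf x p = 0) :
    ∃ n : ℕ, x * p ^ n = 1 := by
  by_contra! h
  refine tprod_one_add_ne_zero_of_summable (f := fun n : ℕ => -(x * p ^ n)) (fun n hn => ?_)
    (summable_norm_neg_mul_pow hp x) (by simpa [pochInf, sub_eq_add_neg] using hx)
  exact h n (by linear_combination -hn)

lemma pochInf_ne_zero_of_norm_lt_one (hp : ‖p‖ < 1) {x : ℂ} (hx : ‖x‖ < 1) :
    pochInf x p ≠ 0 := by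
  intro h
  obtain ⟨n, hn⟩ := exists_mul_pow_eq_one_of_pochInf_eq_zero hp h
  have h1 : ‖x‖ * ‖p‖ ^ n = 1 := by rw [← norm_pow, ← norm_mul, hn, norm_one]
  have h2 : ‖p‖ ^ n ≤ 1 := pow_le_one₀ (norm_nonneg p) hp.le
  nlinarith [norm_nonneg x]

lemma differentiable_pochInf (hp : ‖p‖ < 1) : Differentiable ℂ fun x => pochInf x p := by
  have hloc : HasProdLocallyUniformlyOn (fun (n : ℕ) (x : ℂ) => 1 + -(x * p ^ n))
      (fun x => ∏' n : ℕ, (1 + -(x * p ^ n))) Set.univ := by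
    refine hasProdLocallyUniformlyOn_of_forall_compact isOpen_univ fun K _ hK => ?_
    obtain ⟨C, hC⟩ := hK.isBounded.exists_norm_le
    refine ((summable_geometric_of_lt_one (norm_nonneg p) hp).mul_left
      C).hasProdUniformlyOn_nat_one_add hK (.of_forall fun n x hx => ?_) (fun _ => by fun_prop)
    rw [norm_neg, norm_mul, norm_pow]
    exact mul_le_mul_of_nonneg_right (hC x hx) (by positivity)
  have hd := hloc.differentiableOn (.of_forall fun _ => by
    simpa [Finset.prod_fn] using DifferentiableOn.finsetProd (fun _ _ => by fun_prop)) isOpen_univ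
  simpa [pochInf, sub_eq_add_neg, differentiableOn_univ] using hd

lemma differentiableAt_theta (hp : ‖p‖ < 1) {x : ℂ} (hx : x ≠ 0) :
    DifferentiableAt ℂ (fun x => theta x p) x := by
  have h := differentiable_pochInf hp
  exact (h x).mul ((h (p / x)).comp x (f := fun x => p / x) (by fun_prop (disch := assumption)))

lemma theta_mul (hp0 : p ≠ 0) (hp : ‖p‖ < 1) {x : ℂ} (hx : x ≠ 0) :
    theta (p * x) p = -(1 / x) * theta x p := by
  have h1 := pochInf_eq_mul hp x
  have h2 := pochInf_eq_mul hp (1 / x)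
  rw [theta, theta, show p / (p * x) = 1 / x by field_simp, h1, h2,
    show 1 / x * p = p / x by ring, mul_comm p x]
  field_simp
  ring

lemma theta_div (x : ℂ) (hp0 : p ≠ 0) (hx : x ≠ 0) : theta (p / x) p = theta x p := by
  rw [theta, theta, mul_comm, show p / (p / x) = x by field_simp]

lemma theta_inv (hp0 : p ≠ 0) (hp : ‖p‖ < 1) {x : ℂ} (hx : x ≠ 0) :
    theta (1 / x) p = -(1 / x) * theta x p := by
  rw [← theta_mul hp0 hp hx, ← theta_div (p * x) hp0 (mul_ne_zero hp0 hx)]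
  congr 1
  field_simp

lemma exists_eq_zpow_of_theta_eq_zero (hp : ‖p‖ < 1) {x : ℂ} (hx : x ≠ 0)
    (h : theta x p = 0) : ∃ n : ℤ, x = p ^ n := by
  rcases mul_eq_zero.1 h with h | h
  · obtain ⟨n, hn⟩ := exists_mul_pow_eq_one_of_pochInf_eq_zero hp h
    exact ⟨-n, by rw [zpow_neg, zpow_natCast]; exact eq_inv_of_mul_eq_one_left hn⟩
  · obtain ⟨n, hn⟩ := exists_mul_pow_eq_one_of_pochInf_eq_zero hp h
    refine ⟨(n + 1 : ℕ), ?_⟩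
    rw [zpow_natCast, pow_succ]
    field_simp at hn
    linear_combination -hn

lemma theta_one (hp : ‖p‖ < 1) : theta 1 p = 0 := by
  rw [theta, pochInf_eq_mul hp]; simp

lemma theta_zpow (hp0 : p ≠ 0) (hp : ‖p‖ < 1) (n : ℤ) : theta (p ^ n) p = 0 := by
  induction n using Int.induction_on with
  | zero => simpa using theta_one hp
  | succ n ih =>
    rw [zpow_add_one₀ hp0, mul_comm, theta_mul hp0 hp (zpow_ne_zero _ hp0), ih, mul_zero]
  | pred n ih =>
    have h0 := zpow_ne_zero (-(n : ℤ) - 1) hp0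
    have h := theta_mul hp0 hp h0
    rw [← zpow_one_add₀ hp0, show 1 + (-(n : ℤ) - 1) = -n by ring, ih] at h
    simpa [h0] using h.symm

/-- Simplicity of the zeros. At 1 it comes from the factor `1 - x`; the functional equation
`theta_mul` carries it to every `p ^ n`, since in the product rule the term containing the value of
`theta` drops out. -/
lemma exists_hasDerivAt_theta_zpow (hp0 : p ≠ 0) (hp : ‖p‖ < 1) (n : ℤ) :
    ∃ d ≠ 0, HasDerivAt (fun x => theta x p) d (p ^ n) := by
  induction n using Int.induction_on with
  | zero =>
    have hF : DifferentiableAt ℂ (fun x => pochInf (x * p) p * pochInf (p / x) p) 1 := by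
      have h := differentiable_pochInf hp
      exact ((h (1 * p)).comp 1 (f := fun x => x * p) (by fun_prop)).mul
        ((h (p / 1)).comp 1 (f := fun x => p / x) (by fun_prop (disch := norm_num)))
    have h := ((hasDerivAt_id (1 : ℂ)).const_sub 1).mul hF.hasDerivAt
    refine ⟨_, ?_, by
      rw [zpow_zero]
      refine h.congr_of_eventuallyEq (.of_forall fun x => ?_)
      simp only [theta, pochInf_eq_mul hp x, Pi.mul_apply, id]
      ring⟩
    have := pochInf_ne_zero_of_norm_lt_one hp hp
    simpa using this
  | succ n ih =>
    obtain ⟨d, hd, h⟩ := ih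
    set y := p ^ ((n : ℤ) + 1) with hy
    have hy0 : y ≠ 0 := zpow_ne_zero _ hp0
    have hyp : y / p = p ^ (n : ℤ) := by rw [hy, zpow_add_one₀ hp0]; field_simp
    have h1 : HasDerivAt (fun x => theta (x / p) p) (d * (1 / p)) y :=
      HasDerivAt.comp (h₂ := fun x => theta x p) (h := fun x => x / p) y (by rwa [hyp])
        ((hasDerivAt_id y).div_const p)
    have h2 : DifferentiableAt ℂ (fun x => -(p / x)) y := by fun_prop (disch := assumption)
    refine ⟨_, ?_, (h2.hasDerivAt.mul h1).congr_of_eventuallyEq ?_⟩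
    · rw [hyp, theta_zpow hp0 hp]
      simp [hp0, hy0, hd]
    · filter_upwards [eventually_ne_nhds hy0] with x hx
      have := theta_mul hp0 hp (div_ne_zero hx hp0)
      rw [mul_div_cancel₀ _ hp0] at this
      simp [this]
  | pred n ih =>
    obtain ⟨d, hd, h⟩ := ih
    set y := p ^ (-(n : ℤ) - 1) with hy
    have hy0 : y ≠ 0 := zpow_ne_zero _ hp0
    have hyp : p * y = p ^ (-(n : ℤ)) := by rw [hy, ← zpow_one_add₀ hp0]; congr 1; ring
    have h1 : HasDerivAt (fun x => theta (p * x) p) (d * (p * 1)) y :=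
      HasDerivAt.comp (h₂ := fun x => theta x p) (h := fun x => p * x) y (by rwa [hyp])
        ((hasDerivAt_id y).const_mul p)
    refine ⟨_, ?_, ((hasDerivAt_id y).neg.mul h1).congr_of_eventuallyEq ?_⟩
    · rw [hyp, theta_zpow hp0 hp]
      simp [hp0, hy0, hd]
    · filter_upwards [eventually_ne_nhds hy0] with x hx
      have := theta_mul hp0 hp hx
      simp only [Pi.mul_apply, Pi.neg_apply, id, this]
      field_simp

end Theta

/-- Continuity is required only at `x` itself, as the function `g` of the theorem may be arbitrary
elsewhere. -/
lemma eq_of_dense_of_continuousAt {X Y : Type*} [TopologicalSpace X] [TopologicalSpace Y]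
    [T2Space Y] {s : Set X} (hs : Dense s) {u v : X → Y} {x : X} (hu : ContinuousAt u x)
    (hv : ContinuousAt v x) (huv : ∀ y ∈ s, u y = v y) : u x = v x := by
  have : (𝓝[s] x).NeBot := mem_closure_iff_nhdsWithin_neBot.1 (hs x)
  exact tendsto_nhds_unique_of_eventuallyEq (l := 𝓝[s] x)
    (hu.tendsto.mono_left nhdsWithin_le_nhds) (hv.tendsto.mono_left nhdsWithin_le_nhds)
    (eventually_nhdsWithin_of_forall huv)

/-! ### Symmetric theta functions: algebra, degree zero, division -/

section SymmTheta

variable {p : ℂ} {k l : ℕ} {f g : ℂ → ℂ}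

namespace IsSymmTheta

lemma add (hf : IsSymmTheta p k f) (hg : IsSymmTheta p k g) :
    IsSymmTheta p k fun x => f x + g x where
  holo := hf.holo.add hg.holo
  symm x hx := by rw [hf.symm x hx, hg.symm x hx]
  quasi x hx := by rw [hf.quasi x hx, hg.quasi x hx]; ring

lemma const_mul (hf : IsSymmTheta p k f) (a : ℂ) : IsSymmTheta p k fun x => a * f x where
  holo := hf.holo.const_mul a
  symm x hx := by rw [hf.symm x hx]
  quasi x hx := by rw [hf.quasi x hx]; ring

lemma mul (hf : IsSymmTheta p k f) (hg : IsSymmTheta p l g) :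
    IsSymmTheta p (k + l) fun x => f x * g x where
  holo := hf.holo.mul hg.holo
  symm x hx := by rw [hf.symm x hx, hg.symm x hx]
  quasi x hx := by
    rw [hf.quasi x hx, hg.quasi x hx, pow_add, mul_add, pow_add, one_div, one_div, one_div]
    simp only [mul_inv]
    ring

lemma one : IsSymmTheta p 0 fun _ => 1 where
  holo := differentiableOn_const 1
  symm _ _ := rfl
  quasi _ _ := by simp

lemma zero : IsSymmTheta p k fun _ => 0 where
  holo := differentiableOn_const 0
  symm _ _ := rfl
  quasi _ _ := by simp

lemma prod {ι : Type*} (s : Finset ι) {F : ι → ℂ → ℂ} (h : ∀ i ∈ s, IsSymmTheta p 1 (F i)) :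
    IsSymmTheta p s.card fun x => ∏ i ∈ s, F i x := by
  classical
  induction s using Finset.induction_on with
  | empty => simpa using one
  | insert a s ha ih =>
    have := (h a (Finset.mem_insert_self a s)).mul
      (ih fun i hi => h i (Finset.mem_insert_of_mem hi))
    simpa [Finset.prod_insert ha, Finset.card_insert_of_notMem ha, add_comm] using this

lemma pow (hf : IsSymmTheta p 1 f) (n : ℕ) : IsSymmTheta p n fun x => f x ^ n := by
  simpa using prod (Finset.range n) (F := fun _ => f) fun _ _ => hf

lemma differentiableAt (hf : IsSymmTheta p k f) {x : ℂ} (hx : x ≠ 0) : DifferentiableAt ℂ f x :=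
  hf.holo.differentiableAt (isOpen_compl_singleton.mem_nhds hx)

lemma eq_zero_mul_iff (hf : IsSymmTheta p k f) (hp0 : p ≠ 0) {x : ℂ} (hx : x ≠ 0) :
    f (p * x) = 0 ↔ f x = 0 := by
  rw [hf.quasi x hx]; simp [hp0, hx]

lemma eq_zero_zpow_mul_iff (hf : IsSymmTheta p k f) (hp0 : p ≠ 0) {x : ℂ} (hx : x ≠ 0) (n : ℤ) :
    f (p ^ n * x) = 0 ↔ f x = 0 := by
  induction n using Int.induction_on with
  | zero => simp
  | succ n ih =>
    rw [← ih, add_comm, zpow_one_add₀ hp0, mul_assoc,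
      hf.eq_zero_mul_iff hp0 (mul_ne_zero (zpow_ne_zero _ hp0) hx)]
  | pred n ih =>
    rw [← ih, ← hf.eq_zero_mul_iff hp0 (mul_ne_zero (zpow_ne_zero _ hp0) hx), ← mul_assoc,
      ← zpow_one_add₀ hp0]
    ring_nf

lemma apply_zpow_mul (hf : IsSymmTheta p 0 f) (hp0 : p ≠ 0) {x : ℂ} (hx : x ≠ 0) (n : ℤ) :
    f (p ^ n * x) = f x := by
  have key : ∀ y ≠ 0, f (p * y) = f y := fun y hy => by simpa using hf.quasi y hy
  induction n using Int.induction_on with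
  | zero => simp
  | succ n ih =>
    rw [← ih, add_comm, zpow_one_add₀ hp0, mul_assoc,
      key _ (mul_ne_zero (zpow_ne_zero _ hp0) hx)]
  | pred n ih =>
    rw [← ih, ← key _ (mul_ne_zero (zpow_ne_zero _ hp0) hx), ← mul_assoc, ← zpow_one_add₀ hp0]
    ring_nf

/-- A symmetric theta function of degree zero is constant. -/
lemma exists_eq_const (hp0 : p ≠ 0) (hp : ‖p‖ < 1) (hf : IsSymmTheta p 0 f) :
    ∃ a, ∀ x ≠ 0, f x = a := by
  have hp0' : 0 < ‖p‖ := norm_pos_iff.2 hp0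
  -- A closed fundamental annulus for `x ↦ p x`: a bound on it is a bound on all of `ℂ \ {0}`.
  have hK : IsCompact {x : ℂ | 1 ≤ ‖x‖ ∧ ‖x‖ ≤ ‖p‖⁻¹} := by
    refine Metric.isCompact_of_isClosed_isBounded
      ((isClosed_le continuous_const continuous_norm).inter
        (isClosed_le continuous_norm continuous_const)) ?_
    exact (Metric.isBounded_closedBall (x := (0 : ℂ)) (r := ‖p‖⁻¹)).subset fun x hx => by
      simpa using hx.2
  obtain ⟨C, hC⟩ := hK.exists_bound_of_continuousOn (f := f) fun x hx =>
    (hf.differentiableAt (norm_pos_iff.1 (lt_of_lt_of_le one_pos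
      hx.1))).continuousAt.continuousWithinAt
  have hb : ∀ x ≠ 0, ‖f x‖ ≤ C := by
    intro x hx
    obtain ⟨n, hn1, hn2⟩ := exists_mem_Ico_zpow (norm_pos_iff.2 hx) ((one_lt_inv₀ hp0').2 hp)
    rw [← hf.apply_zpow_mul hp0 hx n]
    have hpn : 0 < ‖p‖ ^ n := zpow_pos hp0' n
    refine hC _ ?_
    rw [Set.mem_ofPred_eq, norm_mul, norm_zpow]
    rw [inv_zpow] at hn1
    rw [zpow_add_one₀ (inv_ne_zero hp0'.ne'), inv_zpow] at hn2
    constructor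
    · calc (1 : ℝ) = ‖p‖ ^ n * (‖p‖ ^ n)⁻¹ := (mul_inv_cancel₀ hpn.ne').symm
        _ ≤ _ := by gcongr
    · calc ‖p‖ ^ n * ‖x‖ ≤ ‖p‖ ^ n * ((‖p‖ ^ n)⁻¹ * ‖p‖⁻¹) := by gcongr
        _ = ‖p‖⁻¹ := by field_simp
  -- Composition with `exp` gives a bounded entire function, to which Liouville's theorem applies.
  have hd : Differentiable ℂ fun z => f (Complex.exp z) := fun z =>
    (hf.differentiableAt (Complex.exp_ne_zero z)).comp z Complex.differentiable_exp.differentiableAt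
  have hbd : Bornology.IsBounded (Set.range fun z => f (Complex.exp z)) := by
    refine isBounded_iff_forall_norm_le.2 ⟨C, ?_⟩
    rintro _ ⟨z, rfl⟩
    exact hb _ (Complex.exp_ne_zero z)
  refine ⟨f (Complex.exp 0), fun x hx => ?_⟩
  simpa [Complex.exp_log hx] using hd.apply_eq_apply_of_bounded hbd (Complex.log x) 0

/-- A continuous quotient of symmetric theta functions is a symmetric theta function. -/
lemma of_mul_eq {s : Set ℂ} (hs : s.Countable) (hp0 : p ≠ 0) (hf : IsSymmTheta p (k + l) f)
    (hg : IsSymmTheta p k g) (hg0 : ∀ x, x ≠ 0 → x ∉ s → g x ≠ 0) {h : ℂ → ℂ}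
    (hh : DifferentiableOn ℂ h {0}ᶜ) (hmul : ∀ x, x ≠ 0 → f x = g x * h x) :
    IsSymmTheta p l h := by
  have hcont : ∀ x ≠ 0, ContinuousAt h x := fun x hx =>
    (hh.differentiableAt (isOpen_compl_singleton.mem_nhds hx)).continuousAt
  -- Off the countable set the identities for `h` follow by cancelling `g`; continuity then gives
  -- them at every nonzero point.
  have hd : Dense ((insert 0 s)ᶜ) := (hs.insert 0).dense_compl ℂ
  have ext : ∀ u v : ℂ → ℂ, (∀ x ≠ 0, ContinuousAt u x) → (∀ x ≠ 0, ContinuousAt v x) →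
      (∀ x, x ≠ 0 → x ∉ s → u x = v x) → ∀ x ≠ 0, u x = v x := by
    intro u v hu hv huv x hx
    refine eq_of_dense_of_continuousAt hd (hu x hx) (hv x hx) fun y hy => ?_
    simp only [Set.mem_compl_iff, Set.mem_insert_iff, not_or] at hy
    exact huv y hy.1 hy.2
  refine ⟨hh, ext _ _ hcont (fun x hx => ?_) fun x hx hxs => ?_,
    ext _ _ (fun x hx => ?_) (fun x hx => ?_) fun x hx hxs => ?_⟩
  · exact ContinuousAt.comp (g := h) (f := fun x => 1 / x) (hcont _ (one_div_ne_zero hx))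
      (continuousAt_const.div continuousAt_id hx)
  · have h1 := hmul x hx
    have h2 := hmul (1 / x) (one_div_ne_zero hx)
    rw [← hf.symm x hx, ← hg.symm x hx, h1] at h2
    exact mul_left_cancel₀ (hg0 x hx hxs) h2
  · exact ContinuousAt.comp (g := h) (f := fun x => p * x) (hcont _ (mul_ne_zero hp0 hx))
      (by fun_prop)
  · exact (continuousAt_const.div (by fun_prop) (by simp [hp0, hx])).mul (hcont x hx)
  · have h1 := hmul x hx
    have h2 := hmul (p * x) (mul_ne_zero hp0 hx)
    rw [hf.quasi x hx, hg.quasi x hx, h1] at h2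
    have h3 := hg0 x hx hxs
    rw [pow_add, mul_add, pow_add] at h2
    have hpk : p ^ k ≠ 0 := pow_ne_zero _ hp0
    have hpl : p ^ l ≠ 0 := pow_ne_zero _ hp0
    have hxk : x ^ (2 * k) ≠ 0 := pow_ne_zero _ hx
    have hxl : x ^ (2 * l) ≠ 0 := pow_ne_zero _ hx
    field_simp at h2 ⊢
    linear_combination -h2

end IsSymmTheta

/-- A holomorphic function that vanishes at the zeros of a holomorphic function with simple zeros
is divisible by it. -/
lemma exists_differentiableOn_mul_eq {U : Set ℂ} (hU : IsOpen U) (hf : DifferentiableOn ℂ f U)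
    (hg : DifferentiableOn ℂ g U) (hg' : ∀ x ∈ U, g x = 0 → deriv g x ≠ 0)
    (hfg : ∀ x ∈ U, g x = 0 → f x = 0) :
    ∃ h : ℂ → ℂ, DifferentiableOn ℂ h U ∧ ∀ x ∈ U, f x = g x * h x := by
  classical
  refine ⟨fun x => if g x = 0 then deriv f x / deriv g x else f x / g x, fun z hz => ?_,
    fun x hx => ?_⟩
  · refine DifferentiableAt.differentiableWithinAt ?_
    have hUz := hU.mem_nhds hz
    by_cases h0 : g z = 0
    -- Near a zero `z` of `g` the quotient equals `dslope f z / dslope g z`, whose denominator is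
    -- nonzero at `z` because the zero is simple.
    · have hdf := (Complex.differentiableOn_dslope hUz).2 hf
      have hdg := (Complex.differentiableOn_dslope hUz).2 hg
      have hne : dslope g z z ≠ 0 := by rw [dslope_same]; exact hg' z hz h0
      refine ((hdf.differentiableAt hUz).div (hdg.differentiableAt hUz) hne).congr_of_eventuallyEq ?_
      filter_upwards [(hdg.differentiableAt hUz).continuousAt.eventually_ne hne, hUz] with x hx hxU
      have e1 := sub_smul_dslope f z x
      have e2 := sub_smul_dslope g z x
      rw [smul_eq_mul, h0, sub_zero] at e2
      rw [smul_eq_mul, hfg z hz h0, sub_zero] at e1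
      by_cases hxz : x = z
      · subst hxz; simp [h0, dslope_same]
      · have hs : x - z ≠ 0 := sub_ne_zero.2 hxz
        have : g x ≠ 0 := by rw [← e2]; exact mul_ne_zero hs hx
        rw [if_neg this, ← e1, ← e2, Pi.div_apply, mul_div_mul_left _ _ hs]
    · refine ((hf.differentiableAt hUz).div (hg.differentiableAt hUz) h0).congr_of_eventuallyEq ?_
      filter_upwards [(hg.differentiableAt hUz).continuousAt.eventually_ne h0] with x hx
      simp [hx]
  · by_cases h0 : g x = 0
    · simp [h0, hfg x hx h0]
    · simp [h0, mul_div_cancel₀]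

end SymmTheta

/-! ### The span of the products of `P` and `Q` -/

section Basis

variable {p : ℂ}

lemma norm_sq_lt_one (hp : ‖p‖ < 1) : ‖p ^ 2‖ < 1 := by
  rw [norm_pow]; exact pow_lt_one₀ (norm_nonneg p) hp two_ne_zero

lemma pochInf_neg_self_ne_zero (hp : ‖p‖ < 1) : pochInf (-p) p ≠ 0 :=
  pochInf_ne_zero_of_norm_lt_one hp (by rwa [norm_neg])

lemma isSymmTheta_P (hp0 : p ≠ 0) (hp : ‖p‖ < 1) : IsSymmTheta p 1 fun x => P p x / x where
  holo x hx := by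
    have hx0 : x ≠ 0 := hx
    refine DifferentiableAt.differentiableWithinAt (DifferentiableAt.div
      (DifferentiableAt.mul_const ?_ _) differentiableAt_id hx0)
    exact DifferentiableAt.comp x (g := fun x => theta x (p ^ 2)) (f := fun x => -x ^ 2)
      (differentiableAt_theta (norm_sq_lt_one hp) (by simpa using hx0)) (by fun_prop)
  symm x hx := by
    have h := theta_inv (pow_ne_zero 2 hp0) (norm_sq_lt_one hp) (x := -x ^ 2) (by simpa using hx)
    rw [P, P, show -(1 / x) ^ 2 = 1 / -x ^ 2 by field_simp, h]
    field_simp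
  quasi x hx := by
    have h := theta_mul (pow_ne_zero 2 hp0) (norm_sq_lt_one hp) (x := -x ^ 2) (by simpa using hx)
    rw [P, P, show -(p * x) ^ 2 = p ^ 2 * -x ^ 2 by ring, h]
    field_simp
    ring

lemma isSymmTheta_Q (hp0 : p ≠ 0) (hp : ‖p‖ < 1) : IsSymmTheta p 1 fun x => Q p x / x where
  holo x hx := by
    have hx0 : x ≠ 0 := hx
    refine DifferentiableAt.differentiableWithinAt (DifferentiableAt.div
      (DifferentiableAt.mul_const (differentiableAt_id.mul ?_) _) differentiableAt_id hx0)
    exact DifferentiableAt.comp x (g := fun x => theta x (p ^ 2)) (f := fun x => -(p * x ^ 2))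
      (differentiableAt_theta (norm_sq_lt_one hp) (by simp [hx0, hp0])) (by fun_prop)
  symm x hx := by
    have h := theta_div (p := p ^ 2) (-(p * x ^ 2)) (pow_ne_zero 2 hp0) (by simp [hx, hp0])
    rw [Q, Q, show -(p * (1 / x) ^ 2) = p ^ 2 / -(p * x ^ 2) by field_simp, h]
    field_simp
  quasi x hx := by
    have h := theta_mul (pow_ne_zero 2 hp0) (norm_sq_lt_one hp) (x := -(p * x ^ 2))
      (by simp [hx, hp0])
    rw [Q, Q, show -(p * (p * x) ^ 2) = p ^ 2 * -(p * x ^ 2) by ring, h]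
    field_simp
    ring

lemma isSymmTheta_theta_mul_theta (hp0 : p ≠ 0) (hp : ‖p‖ < 1) {y : ℂ} (hy : y ≠ 0) :
    IsSymmTheta p 1 fun x => theta (y * x) p * theta (y / x) p where
  holo x hx := by
    have hx0 : x ≠ 0 := hx
    refine DifferentiableAt.differentiableWithinAt (DifferentiableAt.mul ?_ ?_)
    · exact DifferentiableAt.comp x (g := fun x => theta x p) (f := fun x => y * x)
        (differentiableAt_theta hp (mul_ne_zero hy hx0)) (by fun_prop)
    · exact DifferentiableAt.comp x (g := fun x => theta x p) (f := fun x => y / x)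
        (differentiableAt_theta hp (div_ne_zero hy hx0)) (by fun_prop (disch := assumption))
  symm x hx := by rw [mul_comm, show y / (1 / x) = y * x by field_simp, mul_one_div]
  quasi x hx := by
    have h1 := theta_mul hp0 hp (mul_ne_zero hy hx)
    have h2 := theta_mul hp0 hp (div_ne_zero hy (mul_ne_zero hp0 hx))
    rw [show p * (y / (p * x)) = y / x by field_simp] at h2
    rw [show y * (p * x) = p * (y * x) by ring, h1, h2]
    field_simp
    ring

/-- `I` is the reference zero of `P`; there `Q` reduces to `θ(p; p²)`, up to nonzero factors. -/
lemma Q_I_ne_zero (hp0 : p ≠ 0) (hp : ‖p‖ < 1) : Q p Complex.I ≠ 0 := by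
  have h := pochInf_ne_zero_of_norm_lt_one (norm_sq_lt_one hp) hp
  have h' : p ^ 2 / p = p := by field_simp
  simp [Q, theta, h', h, pochInf_neg_self_ne_zero hp]

lemma theta_eq_zero_of_P_eq_zero (hp : ‖p‖ < 1) {x : ℂ} (h : P p x = 0) :
    theta (-x ^ 2) (p ^ 2) = 0 :=
  (mul_eq_zero.1 h).resolve_right (pochInf_neg_self_ne_zero hp)

/-- The equation `-x² = p ^ (2 n)` gives `x = ± p ^ n I`. Writing `-I` as `1 / I` lets the symmetry
`x ↦ 1 / x` be used. -/
lemma exists_eq_zpow_mul_of_P_eq_zero (hp : ‖p‖ < 1) {x : ℂ} (hx : x ≠ 0)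
    (h : P p x = 0) : ∃ n : ℤ, x = p ^ n * Complex.I ∨ x = p ^ n * (1 / Complex.I) := by
  obtain ⟨n, hn⟩ := exists_eq_zpow_of_theta_eq_zero (norm_sq_lt_one hp) (by simpa using hx)
    (theta_eq_zero_of_P_eq_zero hp h)
  refine ⟨n, ?_⟩
  have h2 : (p ^ 2) ^ n = (p ^ n) ^ 2 := by
    rw [← zpow_natCast, ← zpow_natCast, ← zpow_mul, ← zpow_mul, mul_comm]
  rw [h2] at hn
  have : (x - p ^ n * Complex.I) * (x + p ^ n * Complex.I) = 0 := by
    linear_combination -hn - (p ^ n) ^ 2 * Complex.I_sq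
  rcases mul_eq_zero.1 this with h | h
  · exact .inl (sub_eq_zero.1 h)
  · right
    rw [one_div, Complex.inv_I]
    linear_combination h

lemma countable_zeros_P (hp : ‖p‖ < 1) : {x : ℂ | x ≠ 0 ∧ P p x = 0}.Countable := by
  refine ((Set.countable_range fun n : ℤ => p ^ n * Complex.I).union
    (Set.countable_range fun n : ℤ => p ^ n * (1 / Complex.I))).mono fun x hx => ?_
  obtain ⟨n, h | h⟩ := exists_eq_zpow_mul_of_P_eq_zero hp hx.1 hx.2
  · exact .inl ⟨n, h.symm⟩
  · exact .inr ⟨n, h.symm⟩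

/-- The zeros of `P` form a single orbit of `I` under `x ↦ p x` and `x ↦ 1 / x`, and both maps
preserve vanishing of `f`. -/
lemma IsSymmTheta.eq_zero_iff_of_P_eq_zero {k : ℕ} {f : ℂ → ℂ} (hf : IsSymmTheta p k f)
    (hp0 : p ≠ 0) (hp : ‖p‖ < 1) {x : ℂ} (hx : x ≠ 0) (h : P p x = 0) :
    f x = 0 ↔ f Complex.I = 0 := by
  obtain ⟨n, rfl | rfl⟩ := exists_eq_zpow_mul_of_P_eq_zero hp hx h
  · rw [hf.eq_zero_zpow_mul_iff hp0 Complex.I_ne_zero]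
  · rw [hf.eq_zero_zpow_mul_iff hp0 (one_div_ne_zero Complex.I_ne_zero),
      ← hf.symm _ Complex.I_ne_zero]

lemma Q_ne_zero_of_P_eq_zero (hp0 : p ≠ 0) (hp : ‖p‖ < 1) {x : ℂ} (hx : x ≠ 0)
    (h : P p x = 0) : Q p x ≠ 0 := by
  intro hQ
  have := ((isSymmTheta_Q hp0 hp).eq_zero_iff_of_P_eq_zero hp0 hp hx h).1 (by simp [hQ])
  exact Q_I_ne_zero hp0 hp (by simpa using this)

lemma deriv_P_div_ne_zero (hp0 : p ≠ 0) (hp : ‖p‖ < 1) {x : ℂ} (hx : x ≠ 0) (h : P p x = 0) :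
    deriv (fun x => P p x / x) x ≠ 0 := by
  obtain ⟨n, hn⟩ := exists_eq_zpow_of_theta_eq_zero (norm_sq_lt_one hp) (by simpa using hx)
    (theta_eq_zero_of_P_eq_zero hp h)
  obtain ⟨d, hd, hdθ⟩ := exists_hasDerivAt_theta_zpow (pow_ne_zero 2 hp0) (norm_sq_lt_one hp) n
  have h1 : HasDerivAt (fun x : ℂ => -x ^ 2) (-(2 * x)) x := by
    simpa using ((hasDerivAt_id x).fun_pow 2).fun_neg
  have h2 : HasDerivAt (fun x => P p x) (d * (-(2 * x)) * pochInf (-p) p) x :=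
    (HasDerivAt.comp (h₂ := fun x => theta x (p ^ 2)) (h := fun x : ℂ => -x ^ 2) x
      (by rwa [hn]) h1).mul_const _
  rw [(h2.fun_div (hasDerivAt_id' x) hx).deriv, h]
  simp [hx, hd, pochInf_neg_self_ne_zero hp]

/-- Symmetric theta functions vanishing at `I` are divisible by `P(x) / x`. -/
lemma IsSymmTheta.exists_eq_P_mul {k : ℕ} {f : ℂ → ℂ} (hf : IsSymmTheta p (k + 1) f)
    (hp0 : p ≠ 0) (hp : ‖p‖ < 1) (hI : f Complex.I = 0) :
    ∃ g, IsSymmTheta p k g ∧ ∀ x, x ≠ 0 → f x = P p x / x * g x := by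
  have hP := isSymmTheta_P hp0 hp
  have hz : ∀ x ∈ ({0}ᶜ : Set ℂ), P p x / x = 0 → P p x = 0 := fun x hx h =>
    (div_eq_zero_iff.1 h).resolve_right hx
  obtain ⟨g, hg, hfg⟩ := exists_differentiableOn_mul_eq isOpen_compl_singleton hf.holo hP.holo
    (fun x hx h => deriv_P_div_ne_zero hp0 hp hx (hz x hx h))
    (fun x hx h => (hf.eq_zero_iff_of_P_eq_zero hp0 hp hx (hz x hx h)).2 hI)
  rw [add_comm] at hf
  exact ⟨g, hf.of_mul_eq (countable_zeros_P hp) hp0 hP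
    (fun x hx hxs h => hxs ⟨hx, hz x hx h⟩) hg hfg, hfg⟩

/-- The symmetric theta functions of degree `N` are spanned by the `P ^ k Q ^ (N - k) / x ^ N`. -/
theorem IsSymmTheta.exists_eq_askeyWilson (hp0 : p ≠ 0) (hp : ‖p‖ < 1) (N : ℕ) {f : ℂ → ℂ}
    (hf : IsSymmTheta p N f) :
    ∃ lam : Fin (N + 1) → ℂ, ∀ x, x ≠ 0 → f x = 1 / x ^ N * askeyWilson p N lam x := by
  induction N generalizing f with
  | zero =>
    obtain ⟨a, ha⟩ := hf.exists_eq_const hp0 hp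
    exact ⟨fun _ => a, fun x hx => by simp [askeyWilson, ha x hx]⟩
  | succ N ih =>
    have hQ := isSymmTheta_Q hp0 hp
    have hQI : Q p Complex.I / Complex.I ≠ 0 :=
      div_ne_zero (Q_I_ne_zero hp0 hp) Complex.I_ne_zero
    -- The choice of `a` makes `f - a (Q / x) ^ (N + 1)` vanish at `I`.
    set a := f Complex.I / (Q p Complex.I / Complex.I) ^ (N + 1) with ha
    have hsub := hf.add ((hQ.pow (N + 1)).const_mul (-a))
    obtain ⟨g, hg, hfg⟩ := hsub.exists_eq_P_mul hp0 hp (by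
      rw [ha]; field_simp; ring)
    obtain ⟨lam, hlam⟩ := ih hg
    -- `a` is the coefficient of `P ^ 0`; multiplying the quotient by `P` shifts its coefficients up
    -- by one.
    refine ⟨Fin.cons a lam, fun x hx => ?_⟩
    have h1 := hfg x hx
    rw [hlam x hx] at h1
    have h2 : askeyWilson p (N + 1) (Fin.cons a lam) x =
        a * Q p x ^ (N + 1) + P p x * askeyWilson p N lam x := by
      rw [askeyWilson, Fin.sum_univ_succ, askeyWilson, Finset.mul_sum]
      congr 1
      · simp
      · refine Finset.sum_congr rfl fun k _ => ?_
        simp only [Fin.cons_succ, Fin.val_succ, Nat.add_sub_add_right, pow_succ]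
        ring
    rw [h2]
    have h3 : f x = P p x / x * (1 / x ^ N * askeyWilson p N lam x)
        + a * (Q p x / x) ^ (N + 1) := by linear_combination h1
    rw [h3, div_pow]
    field_simp
    ring

/-- The addition formula for `P` and `Q`, up to a constant factor. -/
lemma exists_theta_mul_theta_eq (hp0 : p ≠ 0) (hp : ‖p‖ < 1) {y : ℂ} (hy : y ≠ 0) :
    ∃ C : ℂ, ∀ x, x ≠ 0 →
      theta (y * x) p * theta (y / x) p = C * (P p y * Q p x - Q p y * P p x) / x := by
  obtain ⟨lam, hlam⟩ :=
    (isSymmTheta_theta_mul_theta hp0 hp hy).exists_eq_askeyWilson hp0 hp 1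
  have key : ∀ x, x ≠ 0 →
      theta (y * x) p * theta (y / x) p = (lam 0 * Q p x + lam 1 * P p x) / x := by
    intro x hx
    rw [hlam x hx, askeyWilson, Fin.sum_univ_two]
    simp
    ring
  -- Evaluation at `x = y`, where `θ(1) = 0`. As `P` and `Q` have no common zero, this makes `(lam
  -- 0, lam 1)` a multiple of `(P(y), -Q(y))`.
  have hyy : lam 0 * Q p y + lam 1 * P p y = 0 := by
    have := key y hy
    rw [div_self hy, theta_one hp, mul_zero, eq_comm] at this
    exact (div_eq_zero_iff.1 this).resolve_right hy
  by_cases hP : P p y = 0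
  · have hQ := Q_ne_zero_of_P_eq_zero hp0 hp hy hP
    have h0 : lam 0 = 0 := by simpa [hP, hQ] using hyy
    refine ⟨-lam 1 / Q p y, fun x hx => ?_⟩
    rw [key x hx, h0, hP]
    field_simp
    ring
  · refine ⟨lam 0 / P p y, fun x hx => ?_⟩
    have h1 : lam 1 = -(lam 0 * Q p y) / P p y := by
      rw [eq_div_iff hP]; linear_combination hyy
    rw [key x hx, h1]
    field_simp
    ring

end Basis

/-! ### The interpolation space and its common denominator -/

section Interpolation

variable {p q c : ℂ}

lemma thetaPoch₂_eq_prod (c q p : ℂ) (n : ℕ) (x : ℂ) : thetaPoch₂ c q p n x =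
    ∏ j ∈ Finset.range n, theta (c * q ^ j * x) p * theta (c * q ^ j / x) p := by
  rw [thetaPoch₂, thetaPoch, thetaPoch, ← Finset.prod_mul_distrib]
  refine Finset.prod_congr rfl fun j _ => ?_
  rw [mul_right_comm, div_mul_eq_mul_div]

lemma thetaPoch₂_eq_mul (c q p x : ℂ) {m N : ℕ} (h : m ≤ N) : thetaPoch₂ c q p N x =
    thetaPoch₂ c q p m x * ∏ k ∈ Finset.range (N - m),
      theta (c * q ^ (m + k) * x) p * theta (c * q ^ (m + k) / x) p := by
  obtain ⟨d, rfl⟩ := Nat.exists_eq_add_of_le h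
  rw [thetaPoch₂_eq_prod, thetaPoch₂_eq_prod, Finset.prod_range_add, Nat.add_sub_cancel_left]

/-- The excluded points lie in a countable set, given by the zeros `p ^ n` of `theta`. -/
lemma dense_regularSet (hp : ‖p‖ < 1) (hq : q ≠ 0) (hc : c ≠ 0) (N : ℕ) :
    Dense (regularSet p q c N) := by
  have hs : (insert 0 (⋃ j : ℕ, ⋃ n : ℤ, {p ^ n / (c * q ^ j), c * q ^ j / p ^ n}) :
      Set ℂ).Countable :=
    (Set.countable_iUnion fun j => Set.countable_iUnion fun n => Set.to_countable _).insert 0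
  refine (hs.dense_compl ℂ).mono fun x hx => ?_
  simp only [Set.mem_compl_iff, Set.mem_insert_iff, Set.mem_iUnion, Set.mem_singleton_iff,
    not_or, not_exists] at hx
  obtain ⟨hx0, hx⟩ := hx
  refine ⟨hx0, ?_⟩
  rw [thetaPoch₂_eq_prod]
  refine Finset.prod_ne_zero_iff.2 fun j _ => mul_ne_zero (fun h => ?_) (fun h => ?_)
  all_goals have hy : c * q ^ j ≠ 0 := mul_ne_zero hc (pow_ne_zero j hq)
  · obtain ⟨n, hn⟩ := exists_eq_zpow_of_theta_eq_zero hp (mul_ne_zero hy hx0) h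
    exact (hx j n).1 (by rw [← hn]; field_simp)
  · obtain ⟨n, hn⟩ := exists_eq_zpow_of_theta_eq_zero hp (div_ne_zero hy hx0) h
    exact (hx j n).2 (by rw [← hn]; field_simp)

/-- Elements of `W` are symmetric theta functions of degree `N` over `(c x, c / x; q, p)_N`. -/
lemma exists_isSymmTheta_of_mem_W (hp0 : p ≠ 0) (hp : ‖p‖ < 1) (hq : q ≠ 0) (hc : c ≠ 0) {N : ℕ}
    {F : regularSet p q c N → ℂ} (hF : F ∈ W p q c N) :
    ∃ H, IsSymmTheta p N H ∧ ∀ x, F x = H x / thetaPoch₂ c q p N x := by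
  induction hF using Submodule.span_induction with
  | mem F hF =>
    obtain ⟨k, hk, g, hg, rfl⟩ := hF
    have h := hg.mul (IsSymmTheta.prod (Finset.range (N - k)) fun j _ =>
      isSymmTheta_theta_mul_theta hp0 hp (mul_ne_zero hc (pow_ne_zero (k + j) hq)))
    rw [Finset.card_range, Nat.add_sub_cancel' hk] at h
    refine ⟨_, h, fun x => ?_⟩
    have hx := x.2.2
    rw [thetaPoch₂_eq_mul c q p x hk] at hx ⊢
    rw [mul_div_mul_right _ _ (right_ne_zero_of_mul hx)]
  | zero => exact ⟨_, IsSymmTheta.zero, fun x => by simp⟩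
  | add F G _ _ hF hG =>
    obtain ⟨H, hH, hFH⟩ := hF
    obtain ⟨K, hK, hGK⟩ := hG
    exact ⟨_, hH.add hK, fun x => by rw [Pi.add_apply, hFH, hGK, add_div]⟩
  | smul a F _ hF =>
    obtain ⟨H, hH, hFH⟩ := hF
    exact ⟨_, hH.const_mul a, fun x => by rw [Pi.smul_apply, hFH, smul_eq_mul, mul_div_assoc]⟩

lemma continuousAt_P (hp0 : p ≠ 0) (hp : ‖p‖ < 1) {x : ℂ} (hx : x ≠ 0) :
    ContinuousAt (P p) x := by
  refine ((((isSymmTheta_P hp0 hp).differentiableAt hx).continuousAt.mul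
    continuousAt_id).congr ?_)
  filter_upwards [eventually_ne_nhds hx] with y hy
  exact div_mul_cancel₀ _ hy

lemma continuousAt_Q (hp0 : p ≠ 0) (hp : ‖p‖ < 1) {x : ℂ} (hx : x ≠ 0) :
    ContinuousAt (Q p) x := by
  refine ((((isSymmTheta_Q hp0 hp).differentiableAt hx).continuousAt.mul
    continuousAt_id).congr ?_)
  filter_upwards [eventually_ne_nhds hx] with y hy
  exact div_mul_cancel₀ _ hy

lemma continuousAt_askeyWilson (hp0 : p ≠ 0) (hp : ‖p‖ < 1) {N : ℕ} (lam : Fin (N + 1) → ℂ)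
    {x : ℂ} (hx : x ≠ 0) : ContinuousAt (askeyWilson p N lam) x := by
  have hP := continuousAt_P hp0 hp hx
  have hQ := continuousAt_Q hp0 hp hx
  unfold askeyWilson
  fun_prop

lemma continuousAt_denom (hp0 : p ≠ 0) (hp : ‖p‖ < 1) (N m : ℕ) {x : ℂ} (hx : x ≠ 0) :
    ContinuousAt (denom p q c N m) x := by
  have hP := continuousAt_P hp0 hp hx
  have hQ := continuousAt_Q hp0 hp hx
  unfold denom
  fun_prop

theorem exists_eq_askeyWilson_div_denom (hp0 : p ≠ 0) (hp : ‖p‖ < 1) (hq : q ≠ 0) (hc : c ≠ 0)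
    {m N : ℕ} (hm : m ≤ N) {g : ℂ → ℂ}
    (hg : (fun x : regularSet p q c N => g x / thetaPoch₂ c q p m x) ∈ W p q c N) :
    ∃ lam : Fin (N + 1) → ℂ, ∀ x ∈ regularSet p q c N, denom p q c N m x ≠ 0 ∧
      g x = 1 / x ^ m * askeyWilson p N lam x * (1 / denom p q c N m x) := by
  obtain ⟨H, hH, hgH⟩ := exists_isSymmTheta_of_mem_W hp0 hp hq hc hg
  obtain ⟨lam, hlam⟩ := hH.exists_eq_askeyWilson hp0 hp N
  choose C hC using fun k : ℕ =>
    exists_theta_mul_theta_eq hp0 hp (mul_ne_zero hc (pow_ne_zero (m + k) hq))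
  set K := ∏ k ∈ Finset.range (N - m), C k
  -- Dividing by `K` is legitimate: at any regular point the nonvanishing of `(c x, c / x; q, p)_N`
  -- forces both `K ≠ 0` and `denom ≠ 0`.
  refine ⟨fun k => lam k / K, fun x hx => ?_⟩
  obtain ⟨hx0, hxN⟩ := hx
  have hprod : (∏ k ∈ Finset.range (N - m),
      theta (c * q ^ (m + k) * x) p * theta (c * q ^ (m + k) / x) p) =
      K * denom p q c N m x / x ^ (N - m) := by
    rw [Finset.prod_congr rfl fun k _ => hC k x hx0, Finset.prod_div_distrib,
      Finset.prod_mul_distrib, Finset.prod_const, Finset.card_range, denom]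
  have hgx := hgH ⟨x, hx0, hxN⟩
  simp only [thetaPoch₂_eq_mul c q p x hm, hprod] at hgx hxN
  have hT := left_ne_zero_of_mul hxN
  have hKd := (div_ne_zero_iff.1 (right_ne_zero_of_mul hxN)).1
  have hK0 := left_ne_zero_of_mul hKd
  have hd := right_ne_zero_of_mul hKd
  refine ⟨hd, ?_⟩
  have haw : askeyWilson p N (fun k => lam k / K) x = askeyWilson p N lam x / K := by
    rw [askeyWilson, askeyWilson, Finset.sum_div]
    exact Finset.sum_congr rfl fun k _ => by ring
  rw [hlam x hx0, div_eq_iff hT] at hgx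
  have hxp : x ^ N = x ^ (N - m) * x ^ m := by rw [← pow_add, Nat.sub_add_cancel hm]
  rw [hgx, haw, hxp]
  field_simp

end Interpolation

end EllipticAW

theorem theorem1p14 (p q c : ℂ) (hp0 : p ≠ 0) (hp1 : ‖p‖ < 1) (hq : q ≠ 0) (hc : c ≠ 0)
    (N : ℕ) :
    (∀ m : ℕ, m ≤ N → ∀ g : ℂ → ℂ,
      (fun x : EllipticAW.regularSet p q c N => g x / EllipticAW.thetaPoch₂ c q p m x)
          ∈ EllipticAW.W p q c N →
      ∃ lam : Fin (N + 1) → ℂ,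
        (∀ x ∈ EllipticAW.regularSet p q c N,
          EllipticAW.denom p q c N m x ≠ 0 ∧
          g x = 1 / x ^ m * EllipticAW.askeyWilson p N lam x
            * (1 / EllipticAW.denom p q c N m x)) ∧
        (∀ x : ℂ, x ≠ 0 → ContinuousAt g x → EllipticAW.denom p q c N m x ≠ 0 →
          g x = 1 / x ^ m * EllipticAW.askeyWilson p N lam x
            * (1 / EllipticAW.denom p q c N m x))) ∧
    (∀ g : ℂ → ℂ,
      (fun x : EllipticAW.regularSet p q c N => g x / EllipticAW.thetaPoch₂ c q p N x)
          ∈ EllipticAW.W p q c N →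
      ∃ lam : Fin (N + 1) → ℂ,
        (∀ x ∈ EllipticAW.regularSet p q c N,
          g x = 1 / x ^ N * EllipticAW.askeyWilson p N lam x) ∧
        (∀ x : ℂ, x ≠ 0 → ContinuousAt g x →
          g x = 1 / x ^ N * EllipticAW.askeyWilson p N lam x)) := by
  open EllipticAW in
  have main : ∀ m : ℕ, m ≤ N → ∀ g : ℂ → ℂ,
      (fun x : regularSet p q c N => g x / thetaPoch₂ c q p m x) ∈ W p q c N →
      ∃ lam : Fin (N + 1) → ℂ,
        (∀ x ∈ regularSet p q c N, denom p q c N m x ≠ 0 ∧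
          g x = 1 / x ^ m * askeyWilson p N lam x * (1 / denom p q c N m x)) ∧
        (∀ x : ℂ, x ≠ 0 → ContinuousAt g x → denom p q c N m x ≠ 0 →
          g x = 1 / x ^ m * askeyWilson p N lam x * (1 / denom p q c N m x)) := by
    intro m hm g hg
    obtain ⟨lam, hlam⟩ := exists_eq_askeyWilson_div_denom hp0 hp1 hq hc hm hg
    refine ⟨lam, hlam, fun x hx hgx hd => ?_⟩
    refine eq_of_dense_of_continuousAt (dense_regularSet hp1 hq hc N) hgx
      (v := fun x => 1 / x ^ m * askeyWilson p N lam x * (1 / denom p q c N m x)) ?_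
      fun y hy => (hlam y hy).2
    exact ((continuousAt_const.div (continuousAt_id.pow m) (pow_ne_zero m hx)).mul
      (continuousAt_askeyWilson hp0 hp1 lam hx)).mul
      (continuousAt_const.div (continuousAt_denom hp0 hp1 N m hx) hd)
  refine ⟨main, fun g hg => ?_⟩
  obtain ⟨lam, h1, h2⟩ := main N le_rfl g hg
  -- For `m = N` the product is empty, so the denominator condition is vacuous.
  have hd : ∀ x, EllipticAW.denom p q c N N x = 1 := fun x => by simp [EllipticAW.denom]
  exact ⟨lam, fun x hx => by simpa [hd] using (h1 x hx).2,
    fun x hx hgx => by simpa [hd] using h2 x hx hgx (by simp [hd])⟩
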